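/- \textbf{Theorem (Approximate Full-Support Existence).} Let $G$ be a finite normal-form game: a finite set of players, a nonempty finite strategy set $\mathcal{A}_p$ for each player $p$, the set $\mathcal{A}=\prod_p \mathcal{A}_p$ of joint strategies, and real-valued payoffs $G_p(a)$ for $a\in\mathcal{A}$. Write $a=(a_p,a_{-p})$, where $a_{-p}\in\mathcal{A}_{-p}=\prod_{q\ne p}\mathcal{A}_q$. A joint distribution is a function $\sigma:\mathcal{A}\to[0,\infty)$ with $\sum_{a}\sigma(a)=1$; its marginals are $\sigma_p(a_p)=\sum_{a_{-p}\in\mathcal{A}_{-p}}\sigma(a_p,a_{-p})$. For tolerances $\epsilon=(\epsilon_p)_p$, a joint distribution $\sigma$ is (i) an $\epsilon$-CE if $\sum_{a_{-p}\in\mathcal{A}_{-p}}\sigma(a_p,a_{-p})\,\bigl(G_p(a'_p,a_{-p})-G_p(a_p,a_{-p})\bigr)\le\epsilon_p$ for every player $p$ and all $a'_p\neq a_p$ in $\mathcal{A}_p$; (ii) an $\epsilon$-CCE if $\sum_{a\in\mathcal{A}}\sigma(a)\,\bigl(G_p(a'_p,a_{-p})-G_p(a)\bigr)\le\epsilon_p$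 for every player $p$ and every $a'_p\in\mathcal{A}_p$; (iii) an $\epsilon$-NE if it factorizes into its marginals, $\sigma(a)=\prod_q\sigma_q(a_q)$ for all $a\in\mathcal{A}$, and $\sum_{a_{-p}\in\mathcal{A}_{-p}}\bigl(\prod_q\sigma_q(a_q)\bigr)\bigl(G_p(a'_p,a_{-p})-G_p(a_p,a_{-p})\bigr)\le\epsilon_p$ for every player $p$ and all $a'_p\neq a_p$ in $\mathcal{A}_p$. If $\epsilon_p>0$ for every player $p$ (in particular, if all $\epsilon_p$ equal a common $\epsilon>0$), then each of the set of $\epsilon$-NEs, the set of $\epsilon$-CEs and the set of $\epsilon$-CCEs contains a full-support distribution, that is, some $\sigma$ with $\sigma(a)>0$ for every $a\in\mathcal{A}$. -/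

import Mathlib

namespace NormalFormGame

/-!
A finite normal-form game with player set `ι` is given by finite strategy sets `A p` and by
real payoffs `G p a` for each player `p` and each joint strategy `a : ∀ p, A p`.
-/

variable {ι : Type*} [Fintype ι] [DecidableEq ι] {A : ι → Type*} [∀ p, Fintype (A p)]
  [∀ p, DecidableEq (A p)]

/-- The gain `G p (s', a₋ₚ) - G p a` of player `p` for deviating from the joint strategy `a` to
`s'` while the other players keep to `a`. -/
def deviationGain (G : ι → (∀ p, A p) → ℝ) (p : ι) (s' : A p) (a : ∀ p, A p) : ℝ :=
  G p (Function.update a p s') - G p a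

/-- The marginal distribution of player `p` under the joint distribution `σ`. -/
def marginal (σ : (∀ p, A p) → ℝ) (p : ι) (s : A p) : ℝ :=
  ∑ a : (∀ p, A p) with a p = s, σ a

/-- The joint distribution is the product of its marginals. -/
def Factorizes (σ : (∀ p, A p) → ℝ) : Prop :=
  ∀ a, σ a = ∏ p, marginal σ p (a p)

/-- The set of `ε`-correlated equilibria: for every player `p` and every pair of strategies
`s' ≠ s` of `p`, the sum over `a₋ₚ` of `σ (s, a₋ₚ) * (G p (s', a₋ₚ) - G p (s, a₋ₚ))` is at most
`ε p`. The sum over `a₋ₚ` is written as a sum over the joint strategies `a` with `a p = s`. -/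
def approxCE (G : ι → (∀ p, A p) → ℝ) (ε : ι → ℝ) : Set ((∀ p, A p) → ℝ) :=
  {σ | σ ∈ stdSimplex ℝ (∀ p, A p) ∧
    ∀ (p : ι) (s s' : A p), s' ≠ s →
      ∑ a : (∀ p, A p) with a p = s, σ a * deviationGain G p s' a ≤ ε p}

/-- The set of `ε`-coarse correlated equilibria: one constraint for each player and each
strategy of that player to deviate to. -/
def approxCCE (G : ι → (∀ p, A p) → ℝ) (ε : ι → ℝ) : Set ((∀ p, A p) → ℝ) :=
  {σ | σ ∈ stdSimplex ℝ (∀ p, A p) ∧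
    ∀ (p : ι) (s' : A p), ∑ a : (∀ p, A p), σ a * deviationGain G p s' a ≤ ε p}

/-- The set of `ε`-Nash equilibria: joint distributions that factorize into their marginals and
satisfy the deviation constraints for every pair of strategies of every player. -/
def approxNE (G : ι → (∀ p, A p) → ℝ) (ε : ι → ℝ) : Set ((∀ p, A p) → ℝ) :=
  {σ | σ ∈ stdSimplex ℝ (∀ p, A p) ∧ Factorizes σ ∧
    ∀ (p : ι) (s s' : A p), s' ≠ s →
      ∑ a : (∀ p, A p) with a p = s,
        (∏ q, marginal σ q (a q)) * deviationGain G p s' a ≤ ε p}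

/-- Every joint strategy has positive mass. -/
def FullSupport (σ : (∀ p, A p) → ℝ) : Prop :=
  ∀ a, 0 < σ a

end NormalFormGame

/-!
One distribution serves all three claims. At temperatures `δ p > 0`, let every player respond to a
joint distribution `σ` with logit weights `exp (u p s / δ p)`, where `u p s` is the expected payoff
of the strategy `s`. The product of these responses depends continuously on `σ`, so Brouwer's
theorem gives a fixed point, a logit equilibrium (`exists_logit_equilibrium`). It is a product and
has full support, because exponentials are positive. A strategy that loses `d > 0` against another
one is played with probability at most `exp (-d / δ p)`, so it contributes at most
`d * exp (-d / δ p) ≤ δ p` to the gain from a deviation (`logit_mul_sub_le`). With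
`δ p = ε p / card (A p)` this bounds each conditional gain by `ε p`, and also their sum over the
strategies of `p`, which is the coarse gain. Since expected payoffs make sense for every joint
distribution, the map acts on a single simplex and not on a product of simplices.

Brouwer's theorem on the standard simplex (`exists_fixedPoint_stdSimplex`) is derived from Scarf's
lemma rather than from Sperner's, so that no triangulation is needed. Order the points of a fine
grid by each coordinate and add one slack element per coordinate. A set is dominant if no point
lies strictly above its minimum in every order. Dominant sets with as many elements as there are
coordinates play the part of the top-dimensional simplices: removing an element and pivoting leads
to exactly one other such set (`Dominant.exists_pair`), and Sperner's parity count gives one that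
carries all colours (`Scarf.exists_dominant_rainbow`). The grid points of a dominant set are close
together (`Grid.exists_close_rainbow`). Colouring `x` by an index `i` with `x i ≤ f x i`, a limit of
such sets is a point `z` with `z i ≤ f z i` for all `i`, and hence fixed.
-/

namespace Scarf

open Finset

/-! ### Dominant sets for a family of linear orders -/

section Dominant

variable {X I α : Type*} [LinearOrder α] {v : I → X → α}

/-- A finite set `S` is dominant for the orders induced by the functions `v i` if no `y` lies, for
every index `i`, strictly above the `i`-minimum of `S`. -/
def Dominant (v : I → X → α) (S : Finset X) : Prop :=
  ∀ y, ∃ i, ∀ x ∈ S, v i y ≤ v i x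

theorem Dominant.mono {S τ : Finset X} (hS : Dominant v S) (h : τ ⊆ S) : Dominant v τ :=
  fun y => (hS y).imp fun _ hi x hx => hi x (h hx)

/-- `m i` is the minimizer of `v i` on `τ`, for every index `i`. -/
def IsArgmin (v : I → X → α) (τ : Finset X) (m : I → X) : Prop :=
  ∀ i, m i ∈ τ ∧ ∀ x ∈ τ, v i (m i) ≤ v i x

theorem exists_isArgmin (v : I → X → α) {τ : Finset X} (hτ : τ.Nonempty) :
    ∃ m, IsArgmin v τ m := by
  choose m hm using fun i => exists_min_image τ (v i) hτ
  exact ⟨m, hm⟩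

/-- Every element of a dominant set is the minimizer for some index. -/
theorem Dominant.exists_argmin_eq {τ : Finset X} {m : I → X} (hv : ∀ i, (v i).Injective)
    (hτ : Dominant v τ) (hm : IsArgmin v τ m) {x : X} (hx : x ∈ τ) : ∃ i, m i = x := by
  obtain ⟨i, hi⟩ := hτ x
  exact ⟨i, hv i (le_antisymm ((hm i).2 x hx) (hi _ (hm i).1))⟩

variable [DecidableEq X]

/-- If the index `a` is not needed to make every element of `τ` a minimizer, then `τ` extends to a
larger dominant set: among the points above the `i`-minimum of `τ` for all `i ≠ a`, add the one
that is maximal for `v a`. -/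
theorem Dominant.exists_insert [Finite X] {τ : Finset X} {m : I → X} (hτ : Dominant v τ)
    (hm : IsArgmin v τ m) {a : I} (ha : ∀ x ∈ τ, ∃ i, i ≠ a ∧ m i = x)
    (hne : ∃ y, ∀ i, i ≠ a → v i (m i) < v i y) :
    ∃ y, y ∉ τ ∧ Dominant v (insert y τ) ∧ ∀ i, i ≠ a → v i (m i) < v i y := by
  obtain ⟨y, hy, hmax⟩ := Set.exists_max_image {y | ∀ i, i ≠ a → v i (m i) < v i y} (v a)
    (Set.toFinite _) hne
  refine ⟨y, fun hyτ => ?_, fun z => ?_, hy⟩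
  · obtain ⟨i, hia, rfl⟩ := ha y hyτ
    exact lt_irrefl _ (hy i hia)
  · by_cases hz : ∀ i, i ≠ a → v i (m i) < v i z
    · refine ⟨a, fun x hx => ?_⟩
      obtain ⟨i, hi⟩ := hτ y
      have hia : i = a := by
        by_contra hia
        exact (hy i hia).not_ge (hi _ (hm i).1)
      subst hia
      rcases mem_insert.1 hx with rfl | hx
      · exact hmax z hz
      · exact (hmax z hz).trans (hi x hx)
    · push Not at hz
      obtain ⟨i, hia, hi⟩ := hz
      refine ⟨i, fun x hx => ?_⟩
      rcases mem_insert.1 hx with rfl | hx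
      · exact hi.trans (hy i hia).le
      · exact hi.trans ((hm i).2 x hx)

theorem insert_unique {τ : Finset X} {m : I → X} (hv : ∀ i, (v i).Injective)
    (hm : IsArgmin v τ m) {a : I} {y z : X}
    (hy : Dominant v (insert y τ)) (hya : ∀ i, i ≠ a → v i (m i) < v i y)
    (hz : Dominant v (insert z τ)) (hza : ∀ i, i ≠ a → v i (m i) < v i z) : y = z := by
  have key : ∀ {y z : X}, Dominant v (insert y τ) → (∀ i, i ≠ a → v i (m i) < v i z) →
      v a z ≤ v a y := by
    intro y z hy hz
    obtain ⟨i, hi⟩ := hy z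
    have hia : i = a := by
      by_contra hia
      exact (hz i hia).not_ge (hi _ (mem_insert_of_mem (hm i).1))
    exact hia ▸ hi y (mem_insert_self _ _)
  exact hv a (le_antisymm (key hz hya) (key hy hza))

variable [Fintype I] [DecidableEq I]

/-- In a dominant set with as many elements as there are indices, elements and indices correspond
bijectively. The index `j` of an element `y` is then one that the rest of the set can do without. -/
theorem exists_index_of_insert {τ : Finset X} {m : I → X} (hv : ∀ i, (v i).Injective)
    (hm : IsArgmin v τ m) (hcard : #τ + 1 = Fintype.card I) {y : X} (hy : y ∉ τ)
    (hd : Dominant v (insert y τ)) :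
    ∃ j, (∀ i, i ≠ j → v i (m i) < v i y) ∧ ∀ x ∈ τ, ∃ i, i ≠ j ∧ m i = x := by
  choose g hg using fun x => hd x
  have hinj : Set.InjOn g (insert y τ : Finset X) := fun x hx z hz hxz =>
    hv (g x) (le_antisymm (hg x z hz) (by rw [hxz]; exact hg z x hx))
  have himg : (insert y τ).image g = univ := by
    rw [← card_eq_iff_eq_univ, card_image_of_injOn hinj, card_insert_of_notMem hy, hcard]
  have hmg : ∀ x ∈ τ, m (g x) = x := fun x hx =>
    hv _ (le_antisymm ((hm _).2 x hx) (hg x _ (mem_insert_of_mem (hm _).1)))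
  have hne : ∀ x ∈ τ, g x ≠ g y := fun x hx h => hy
    (hinj (mem_insert_of_mem hx) (mem_insert_self _ _) h ▸ hx)
  refine ⟨g y, fun i hi => ?_, fun x hx => ⟨g x, hne x hx, hmg x hx⟩⟩
  obtain ⟨x, hx, rfl⟩ := mem_image.1 (himg ▸ mem_univ i : i ∈ (insert y τ).image g)
  rcases mem_insert.1 hx with rfl | hxτ
  · exact absurd rfl hi
  · rw [hmg x hxτ]
    refine lt_of_le_of_ne (hg x y (mem_insert_self _ _)) fun h => hy ?_
    rw [← hv _ h]
    exact hxτ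

/-- The pivot step: a dominant set with one element fewer than there are indices has exactly two
dominant extensions by one element. The hypothesis `hne` excludes that one of them is missing. -/
theorem Dominant.exists_pair [Finite X] {τ : Finset X} {m : I → X} (hv : ∀ i, (v i).Injective)
    (hτ : Dominant v τ) (hm : IsArgmin v τ m) (hcard : #τ + 1 = Fintype.card I)
    (hne : ∀ a, (∀ x ∈ τ, ∃ i, i ≠ a ∧ m i = x) → ∃ y, ∀ i, i ≠ a → v i (m i) < v i y) :
    ∃ y z, y ≠ z ∧ ∀ x, (x ∉ τ ∧ Dominant v (insert x τ)) ↔ x = y ∨ x = z := by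
  obtain ⟨a, -, b, -, hab, hmab⟩ := exists_ne_map_eq_of_card_lt_of_maps_to
    (s := (univ : Finset I)) (t := τ) (f := m) (by rw [card_univ]; lia) (fun i _ => (hm i).1)
  have hfree : ∀ {a b : I}, a ≠ b → m a = m b → ∀ x ∈ τ, ∃ i, i ≠ a ∧ m i = x := by
    intro a b hab hmab x hx
    obtain ⟨i, rfl⟩ := hτ.exists_argmin_eq hv hm hx
    by_cases hi : i = a
    · exact ⟨b, hab.symm, by rw [hi, hmab]⟩
    · exact ⟨i, hi, rfl⟩
  have ha := hfree hab hmab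
  have hb := hfree hab.symm hmab.symm
  obtain ⟨y, hyτ, hyd, hy⟩ := hτ.exists_insert hm ha (hne a ha)
  obtain ⟨z, hzτ, hzd, hz⟩ := hτ.exists_insert hm hb (hne b hb)
  refine ⟨y, z, ?_, fun x => ⟨fun ⟨hxτ, hxd⟩ => ?_, ?_⟩⟩
  · rintro rfl
    obtain ⟨i, hi⟩ := hτ y
    by_cases hia : i = a
    · exact (hz i (hia ▸ hab)).not_ge (hi _ (hm i).1)
    · exact (hy i hia).not_ge (hi _ (hm i).1)
  · obtain ⟨j, hj, hjfree⟩ := exists_index_of_insert hv hm hcard hxτ hxd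
    have hj' : j = a ∨ j = b := by
      by_contra! hj'
      -- Otherwise `τ` is the image of `univ.erase j`, on which `m` is not injective.
      refine hab (inj_on_of_surj_on_of_card_le (s := univ.erase j) (t := τ) (fun i _ => m i)
        (fun i _ => (hm i).1) (fun x hx => ?_) ?_ (mem_erase.2 ⟨hj'.1.symm, mem_univ _⟩)
        (mem_erase.2 ⟨hj'.2.symm, mem_univ _⟩) hmab)
      · obtain ⟨i, hi, h⟩ := hjfree x hx
        exact ⟨i, mem_erase.2 ⟨hi, mem_univ _⟩, h⟩
      · rw [card_erase_of_mem (mem_univ _), card_univ]; lia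
    rcases hj' with rfl | rfl
    · exact Or.inl (insert_unique hv hm hxd hj hyd hy)
    · exact Or.inr (insert_unique hv hm hxd hj hzd hz)
  · rintro (rfl | rfl)
    · exact ⟨hyτ, hyd⟩
    · exact ⟨hzτ, hzd⟩

end Dominant

/-! ### Slack elements and the colouring theorem -/

section Slack

variable {X I α : Type*} [LinearOrder α] {v : I → X → α} {e : I → X}

/-- The elements `e i` are slack elements: `e i` is the least element of the `i`-th order and lies,
in all other orders, above every element that is not slack. -/
structure IsSlack (v : I → X → α) (e : I → X) : Prop where
  injective : Function.Injective e
  bot_le : ∀ i x, v i (e i) ≤ v i x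
  lt_of_ne : ∀ i j, j ≠ i → ∀ x, x ∉ Set.range e → v i x < v i (e j)

variable [Fintype X] [DecidableEq X] [Fintype I] [DecidableEq I]

open Classical in
/-- The dominant sets with as many elements as there are indices. -/
noncomputable def rooms (v : I → X → α) : Finset (Finset X) :=
  {S | Dominant v S ∧ #S = Fintype.card I}

omit [DecidableEq X] [DecidableEq I] in
theorem mem_rooms {S : Finset X} : S ∈ rooms v ↔ Dominant v S ∧ #S = Fintype.card I := by
  simp [rooms]

omit [Fintype X] in
theorem image_erase_card_add_one (he : IsSlack v e) (b : I) :
    #((univ.erase b).image e) + 1 = Fintype.card I := by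
  rw [card_image_of_injective _ he.injective, card_erase_add_one (mem_univ b), card_univ]

omit [Fintype X] in
/-- The slack element `e a` lies above the `i`-minimum of `τ` for all `i ≠ a`, unless `τ` consists of
all slack elements but one. -/
theorem IsSlack.argmin_lt (hv : ∀ i, (v i).Injective) (he : IsSlack v e) {τ : Finset X} {m : I → X}
    (hm : IsArgmin v τ m) (hcard : #τ + 1 = Fintype.card I)
    (hex : ∀ b, τ ≠ (univ.erase b).image e) {i a : I} (hia : i ≠ a) : v i (m i) < v i (e a) := by
  by_cases hr : m i ∈ Set.range e
  · obtain ⟨k, hk⟩ := hr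
    by_cases hki : k = i
    · rw [← hk, hki]
      exact lt_of_le_of_ne (he.bot_le i _) fun h => hia (he.injective (hv i h))
    · exfalso
      refine hex i (eq_of_subset_of_card_le (fun x hx => ?_) ?_)
      · by_cases hxr : x ∈ Set.range e
        · obtain ⟨l, rfl⟩ := hxr
          refine mem_image_of_mem e (mem_erase.2 ⟨?_, mem_univ _⟩)
          rintro rfl
          have := le_antisymm ((hm l).2 _ hx) (he.bot_le l _)
          exact hki (he.injective (hk.trans (hv l this)))
        · exact absurd ((hm i).2 x hx) (by rw [← hk]; exact (he.lt_of_ne i k hki x hxr).not_ge)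
      · have := image_erase_card_add_one he i
        lia
  · exact he.lt_of_ne i a hia.symm _ hr

omit [DecidableEq I] in
/-- The rooms that contain a set `τ` with one element fewer are the extensions of `τ` by the
elements that make it dominant. -/
theorem rooms_filter_subset_eq_image {τ : Finset X} (hcard : #τ + 1 = Fintype.card I)
    {Y : Finset X} (hY : ∀ x, (x ∉ τ ∧ Dominant v (insert x τ)) ↔ x ∈ Y) :
    #{S ∈ rooms v | τ ⊆ S} = #Y := by
  have : ({S ∈ rooms v | τ ⊆ S} : Finset (Finset X)) = Y.image fun x => insert x τ := by
    ext S
    simp only [mem_filter, mem_rooms, mem_image]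
    constructor
    · rintro ⟨⟨hd, hc⟩, hsub⟩
      obtain ⟨x, hx⟩ := card_eq_one.1 (show #(S \ τ) = 1 by
        have := card_sdiff_add_card_eq_card hsub
        lia)
      have hxS : x ∈ S \ τ := hx ▸ mem_singleton_self x
      have hins : insert x τ = S := by
        rw [insert_eq, ← hx, sdiff_union_of_subset hsub]
      exact ⟨x, (hY x).1 ⟨(mem_sdiff.1 hxS).2, hins ▸ hd⟩, hins⟩
    · rintro ⟨x, hx, rfl⟩
      obtain ⟨hxτ, hd⟩ := (hY x).2 hx
      exact ⟨⟨hd, by rw [card_insert_of_notMem hxτ, hcard]⟩, subset_insert _ _⟩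
  rw [this, card_image_of_injOn]
  intro x hx y hy hxy
  have hxτ := ((hY x).2 hx).1
  have : x ∈ insert y τ := by
    rw [← show insert x τ = insert y τ from hxy]
    exact mem_insert_self _ _
  exact (mem_insert.1 this).resolve_right hxτ

theorem even_card_rooms_filter (hv : ∀ i, (v i).Injective) (he : IsSlack v e) {τ : Finset X}
    (hcard : #τ + 1 = Fintype.card I) (hex : ∀ b, τ ≠ (univ.erase b).image e) :
    Even #{S ∈ rooms v | τ ⊆ S} := by
  by_cases hτ : Dominant v τ
  · have hne : τ.Nonempty := by
      rw [nonempty_iff_ne_empty]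
      rintro rfl
      obtain ⟨b⟩ : Nonempty I := Fintype.card_pos_iff.1 (by lia)
      refine hex b (card_eq_zero.1 ?_).symm
      have := image_erase_card_add_one he b
      rw [card_empty] at hcard
      lia
    obtain ⟨m, hm⟩ := exists_isArgmin v hne
    obtain ⟨y, z, hyz, h⟩ := hτ.exists_pair hv hm hcard fun a _ =>
      ⟨e a, fun i hia => he.argmin_lt hv hm hcard hex hia⟩
    rw [rooms_filter_subset_eq_image hcard (Y := {y, z}) (by simpa using h), card_pair hyz]
    exact even_two
  · rw [filter_eq_empty_iff.2 fun S hS hsub => hτ ((mem_rooms.1 hS).1.mono hsub)]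
    exact Even.zero

/-- All slack elements but `e b` extend to a room only by the `v b`-maximal remaining element. -/
theorem card_rooms_filter_slack (hv : ∀ i, (v i).Injective) (he : IsSlack v e) (b : I) :
    #{S ∈ rooms v | (univ.erase b).image e ⊆ S} = 1 := by
  set τ := (univ.erase b).image e with hτ
  have hmem : ∀ i, i ≠ b → e i ∈ τ := fun i hi =>
    mem_image_of_mem e (mem_erase.2 ⟨hi, mem_univ _⟩)
  have hb : e b ∉ τ := by
    simp only [hτ, mem_image, mem_erase, not_exists, not_and]
    exact fun i hi h => hi.1 (he.injective h)
  obtain ⟨y, hy, hmax⟩ := exists_max_image τᶜ (v b) ⟨e b, mem_compl.2 hb⟩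
  rw [mem_compl] at hy
  rw [rooms_filter_subset_eq_image (Y := {y}) (image_erase_card_add_one he b), card_singleton]
  intro x
  rw [mem_singleton]
  constructor
  · rintro ⟨hx, hd⟩
    obtain ⟨i, hi⟩ := hd y
    have hib : i = b := by
      by_contra hib
      have := le_antisymm (hi _ (mem_insert_of_mem (hmem i hib))) (he.bot_le i y)
      exact hy (hv i this ▸ hmem i hib)
    subst hib
    exact hv i (le_antisymm (hmax x (mem_compl.2 hx)) (hi x (mem_insert_self _ _)))
  · rintro rfl
    refine ⟨hy, fun z => ?_⟩
    by_cases hz : z ∈ τ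
    · obtain ⟨i, -, rfl⟩ := mem_image.1 hz
      exact ⟨i, fun w _ => he.bot_le i w⟩
    · refine ⟨b, fun w hw => (hmax z (mem_compl.2 hz)).trans ?_⟩
      rcases mem_insert.1 hw with rfl | hw
      · exact le_rfl
      · obtain ⟨j, hj, rfl⟩ := mem_image.1 hw
        have hjb := (mem_erase.1 hj).1
        by_cases hxr : x ∈ Set.range e
        · obtain ⟨k, rfl⟩ := hxr
          obtain rfl : k = b := by
            by_contra hk
            exact hy (hmem k hk)
          exact he.bot_le k _
        · exact (he.lt_of_ne b j hjb x hxr).le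

omit [Fintype X] in
/-- A set with as many elements as there are colours that misses some colour has an even number
(`0` or `2`) of subsets with one element fewer whose colours are exactly those other than `i₀`. -/
theorem even_card_doors_filter {c : X → I} {i₀ : I} {S : Finset X} (hS : #S = Fintype.card I)
    (hc : S.image c ≠ univ) :
    Even #{τ ∈ S.powerset | τ.image c = univ.erase i₀ ∧ #τ + 1 = Fintype.card I} := by
  set D := ({τ ∈ S.powerset | τ.image c = univ.erase i₀ ∧ #τ + 1 = Fintype.card I} :
    Finset (Finset X)) with hD
  have hDmem : ∀ {τ}, τ ∈ D ↔ τ ⊆ S ∧ τ.image c = univ.erase i₀ ∧ #τ + 1 = Fintype.card I := by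
    simp [hD]
  have hinj : ∀ {τ}, τ ∈ D → Set.InjOn c τ := fun {τ} hτ => by
    obtain ⟨-, himg, hcard⟩ := hDmem.1 hτ
    rw [← card_image_iff, himg]
    have := card_erase_add_one (mem_univ i₀)
    rw [card_univ] at this
    lia
  have herase : ∀ {τ}, τ ∈ D → ∃ x ∈ S, x ∉ τ ∧ τ = S.erase x := fun {τ} hτ => by
    obtain ⟨hsub, -, hcard⟩ := hDmem.1 hτ
    obtain ⟨x, hx, hxτ⟩ := exists_mem_notMem_of_card_lt_card (s := τ) (t := S) (by lia)
    refine ⟨x, hx, hxτ, eq_of_subset_of_card_le (subset_erase.2 ⟨hsub, hxτ⟩) ?_⟩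
    have := card_erase_add_one hx
    lia
  rcases D.eq_empty_or_nonempty with h | ⟨τ, hτ⟩
  · rw [h]; exact Even.zero
  · obtain ⟨x, hx, hxτ, rfl⟩ := herase hτ
    obtain ⟨-, himg, hcard⟩ := hDmem.1 hτ
    have hcx : c x ≠ i₀ := by
      rintro rfl
      refine hc ?_
      rw [← insert_erase hx, image_insert, himg, insert_erase (mem_univ _)]
    obtain ⟨z, hz, hzx⟩ := mem_image.1 (himg ▸ mem_erase.2 ⟨hcx, mem_univ _⟩ :
      c x ∈ (S.erase x).image c)
    obtain ⟨hzne, hzS⟩ := mem_erase.1 hz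
    -- The doors are obtained by removing one of the two elements of the repeated colour.
    have hpair : D = {S.erase x, S.erase z} := by
      ext ρ
      rw [mem_insert, mem_singleton]
      constructor
      · intro hρ
        obtain ⟨w, hw, -, rfl⟩ := herase hρ
        by_contra! hne
        have hwx : x ≠ w := fun h => hne.1 (h ▸ rfl)
        have hwz : z ≠ w := fun h => hne.2 (h ▸ rfl)
        exact hzne (hinj hρ (mem_coe.2 (mem_erase.2 ⟨hwz, hzS⟩))
          (mem_coe.2 (mem_erase.2 ⟨hwx, hx⟩)) hzx)
      · rintro (rfl | rfl)
        · exact hτ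
        · refine hDmem.2 ⟨erase_subset _ _, ?_, by rw [card_erase_add_one hzS, hS]⟩
          rw [← himg, ← insert_erase (mem_erase.2 ⟨hzne.symm, hx⟩ : x ∈ S.erase z),
            ← insert_erase hz, image_insert, image_insert, erase_right_comm, hzx]
    rw [hpair, card_pair]
    · exact even_two
    · intro h
      exact (h ▸ notMem_erase x S : x ∉ S.erase z) (mem_erase.2 ⟨hzne.symm, hx⟩)

/-- **Scarf's lemma**: if the slack elements carry their own colours, some dominant set carries all
colours. The pairs of a room and a door in it, where a door has exactly the colours other than a
fixed `i₀`, are odd in number when counted by doors, since only the door made of slack elements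
lies in an odd number of rooms; so some room has an odd number of doors and carries all colours. -/
theorem exists_dominant_rainbow [Nonempty I] (hv : ∀ i, (v i).Injective) (he : IsSlack v e)
    (c : X → I) (hc : ∀ i, c (e i) = i) :
    ∃ S, Dominant v S ∧ S.image c = univ := by
  obtain ⟨i₀⟩ := ‹Nonempty I›
  by_contra! hno
  set D : Finset (Finset X) := {τ | τ.image c = univ.erase i₀ ∧ #τ + 1 = Fintype.card I} with hD
  have hcount := sum_card_bipartiteAbove_eq_sum_card_bipartiteBelow (s := D) (t := rooms v)
    (fun τ S => τ ⊆ S)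
  have hrooms : Even (∑ S ∈ rooms v, #(bipartiteBelow (fun τ S => τ ⊆ S) D S)) := by
    refine even_sum _ fun S hS => ?_
    obtain ⟨hd, hcard⟩ := mem_rooms.1 hS
    have hdef : bipartiteBelow (fun τ S => τ ⊆ S) D S =
        {τ ∈ S.powerset | τ.image c = univ.erase i₀ ∧ #τ + 1 = Fintype.card I} := by
      ext τ
      simp [bipartiteBelow, hD, and_comm]
    rw [hdef]
    exact even_card_doors_filter hcard (hno S hd)
  have himg : ((univ.erase i₀).image e).image c = univ.erase i₀ := by
    rw [image_image, show c ∘ e = id from funext hc, image_id]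
  have hmem : (univ.erase i₀).image e ∈ D := by
    simp only [hD, mem_filter, mem_univ, true_and]
    exact ⟨himg, image_erase_card_add_one he i₀⟩
  have hdoors : Even (∑ τ ∈ D.erase ((univ.erase i₀).image e),
      #(bipartiteAbove (fun τ S => τ ⊆ S) (rooms v) τ)) := by
    refine even_sum _ fun τ hτ => ?_
    obtain ⟨hne, hτD⟩ := mem_erase.1 hτ
    obtain ⟨hτc, hcard⟩ := (mem_filter.1 hτD).2
    refine even_card_rooms_filter hv he hcard fun b hb => ?_
    have hbi : b = i₀ := by
      rw [hb, image_image, show c ∘ e = id from funext hc, image_id] at hτc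
      by_contra hbi
      have : b ∈ univ.erase b := by
        rw [hτc]
        exact mem_erase.2 ⟨hbi, mem_univ _⟩
      exact notMem_erase b _ this
    exact hne (hbi ▸ hb)
  rw [← hcount, ← add_sum_erase _ _ hmem] at hrooms
  have hone : #(bipartiteAbove (fun τ S => τ ⊆ S) (rooms v) ((univ.erase i₀).image e)) = 1 :=
    card_rooms_filter_slack hv he i₀
  rw [hone] at hrooms
  rw [Nat.even_iff] at hrooms hdoors
  lia

end Slack

end Scarf

/-! ### A fixed point theorem for the standard simplex -/

section FixedPoint

open Finset Filter Topology

variable {J : Type*} [Fintype J] [DecidableEq J]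

/-- The points of the standard simplex with coordinates in `(1 / N) ℤ`, scaled by `N`. -/
abbrev Grid (J : Type*) [Fintype J] [DecidableEq J] (N : ℕ) : Type _ :=
  {k : J → Fin (N + 1) // ∑ i, (k i : ℕ) = N}

/-- Coordinates of grid points (`Sum.inl`, scaled by `N`) and of slack points (`Sum.inr`). The slack
point of `i` lies below the simplex in the `i`-th coordinate, and above it in all others. -/
def gridCoord {N : ℕ} (i : J) : Grid J N ⊕ J → ℤ
  | .inl k => (k.1 i : ℕ)
  | .inr j => if j = i then -1 else N + 1

theorem Grid.exists_ge [Nonempty J] {N : ℕ} (l : J → ℕ) (hl : ∑ i, l i ≤ N) :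
    ∃ k : Grid J N, ∀ i, l i ≤ (k.1 i : ℕ) := by
  obtain ⟨j⟩ := ‹Nonempty J›
  set l' : J → ℕ := l + Pi.single j (N - ∑ i, l i) with hl'
  have hsum : ∑ i, l' i = N := by
    simp only [hl', Pi.add_apply, sum_add_distrib, sum_pi_single', mem_univ, if_true]
    lia
  have hle : ∀ i, l' i ≤ N := fun i => hsum ▸ single_le_sum (fun _ _ => Nat.zero_le _) (mem_univ i)
  exact ⟨⟨fun i => ⟨l' i, Nat.lt_succ_of_le (hle i)⟩, hsum⟩, fun i => Nat.le_add_right _ _⟩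

/-- Scarf's lemma on the grid: every colouring of the grid has grid points `k₀` and `t i`, all close
together, such that `t i` has colour `i` or an `i`-th coordinate close to `0`. -/
theorem Grid.exists_close_rainbow [Nonempty J] {N : ℕ} (c : Grid J N → J) :
    ∃ (k₀ : Grid J N) (t : J → Grid J N),
      (∀ i j, |((t i).1 j : ℤ) - (k₀.1 j : ℤ)| ≤ Fintype.card J) ∧
      ∀ i, c (t i) = i ∨ ((t i).1 i : ℤ) ≤ Fintype.card J := by
  set X := Grid J N ⊕ J
  set q : J → X → ℤ := gridCoord
  have hqr : ∀ i j, q i (.inr j) = if j = i then -1 else (N : ℤ) + 1 := fun _ _ => rfl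
  have hql : ∀ i (k : Grid J N), q i (.inl k) = (k.1 i : ℕ) := fun _ _ => rfl
  -- Ties between equal coordinates are broken by an arbitrary enumeration.
  set v : J → X → ℤ ×ₗ Fin (Fintype.card X) := fun i x => toLex (q i x, Fintype.equivFin X x)
  have hv : ∀ i, (v i).Injective := fun i x y h => by
    have := congrArg (fun z => (ofLex z).2) h
    exact (Fintype.equivFin X).injective this
  have hle : ∀ {i x y}, v i x ≤ v i y → q i x ≤ q i y := fun {i x y} h => by
    rcases Prod.Lex.toLex_le_toLex.1 h with h | h
    · exact h.le
    · exact h.1.le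
  have hlt : ∀ {i x y}, q i x < q i y → v i x < v i y := fun {i x y} h =>
    Prod.Lex.toLex_lt_toLex.2 (Or.inl h)
  have hbd : ∀ i (k : Grid J N), (k.1 i : ℕ) ≤ N := fun i k => Nat.lt_succ_iff.1 (k.1 i).2
  have he : Scarf.IsSlack v (Sum.inr : J → X) := by
    refine ⟨Sum.inr_injective, fun i x => ?_, fun i j hji x hx => hlt ?_⟩
    · by_cases hx : x = .inr i
      · rw [hx]
      · refine (hlt ?_).le
        rw [hqr, if_pos rfl]
        rcases x with k | j
        · rw [hql]; lia
        · rw [hqr, if_neg fun h => hx (congrArg Sum.inr h)]; lia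
    · rcases x with k | l
      · rw [hql, hqr, if_neg hji]
        have := hbd i k
        lia
      · exact absurd ⟨l, rfl⟩ hx
  obtain ⟨S, hS, hcS⟩ := Scarf.exists_dominant_rainbow hv he (Sum.elim c id) (fun _ => rfl)
  set C : Finset J := {i | Sum.inr i ∉ S} with hC
  have hCmem : ∀ {i}, i ∈ C ↔ Sum.inr i ∉ S := by simp [hC]
  have hdom : ∀ k : Grid J N, ∃ i ∈ C, ∀ x : Grid J N, .inl x ∈ S →
      (k.1 i : ℕ) ≤ (x.1 i : ℕ) := by
    intro k
    obtain ⟨i, hi⟩ := hS (.inl k)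
    refine ⟨i, hCmem.2 fun h => ?_, fun x hx => ?_⟩
    · have := hle (hi _ h)
      rw [hql, hqr, if_pos rfl] at this
      lia
    · have := hle (hi _ hx)
      rw [hql, hql] at this
      exact_mod_cast this
  have hcol : ∀ i ∈ C, ∃ x : Grid J N, .inl x ∈ S ∧ c x = i := by
    intro i hi
    obtain ⟨x, hx, hxi⟩ := mem_image.1 (hcS ▸ mem_univ i : i ∈ S.image (Sum.elim c id))
    rcases x with x | j
    · exact ⟨x, hx, hxi⟩
    · obtain rfl : j = i := hxi
      exact absurd hx (hCmem.1 hi)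
  set T : Finset (Grid J N) := {x | .inl x ∈ S} with hT
  have hTmem : ∀ {x}, x ∈ T ↔ .inl x ∈ S := by simp [hT]
  obtain ⟨k₀, hk₀⟩ : T.Nonempty := by
    obtain ⟨k, -⟩ := Grid.exists_ge (J := J) (N := N) 0 (by simp)
    obtain ⟨i, hi, -⟩ := hdom k
    obtain ⟨x, hx, -⟩ := hcol i hi
    exact ⟨x, hTmem.2 hx⟩
  choose m hmT hmin using fun i => exists_min_image T (fun x => (x.1 i : ℕ)) ⟨k₀, hk₀⟩
  -- The lower bounds in the directions of `C` nearly exhaust the total `N`: otherwise a grid point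
  -- would lie strictly above `T` in all these directions.
  have hsum : N < ∑ i ∈ C, ((m i).1 i + 1 : ℕ) := by
    by_contra! h
    obtain ⟨k, hk⟩ := Grid.exists_ge (J := J) (N := N)
      (fun i => if i ∈ C then ((m i).1 i : ℕ) + 1 else 0) (by simpa [sum_ite_mem] using h)
    obtain ⟨i, hi, hik⟩ := hdom k
    have h1 := hk i
    have h2 := hik _ (hTmem.1 (hmT i))
    rw [if_pos hi] at h1
    lia
  set l : J → ℕ := fun i => if i ∈ C then ((m i).1 i : ℕ) else 0 with hl
  have hlle : ∀ x ∈ T, ∀ i, l i ≤ (x.1 i : ℕ) := fun x hx i => by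
    by_cases hi : i ∈ C
    · simpa [hl, hi] using hmin i x hx
    · simp [hl, hi]
  have hlsum : N < ∑ i, l i + Fintype.card J := by
    have h1 : ∑ i, l i = ∑ i ∈ C, ((m i).1 i : ℕ) := by simp [hl, sum_ite_mem]
    have h2 := card_le_univ C
    rw [sum_add_distrib, sum_const, smul_eq_mul, mul_one] at hsum
    lia
  have hub : ∀ x ∈ T, ∀ i, (x.1 i : ℕ) ≤ l i + Fintype.card J := fun x hx i => by
    have h1 : ∑ j, ((x.1 j : ℕ) - l j) + ∑ j, l j = N := by
      rw [← sum_add_distrib]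
      exact (sum_congr rfl fun j _ => Nat.sub_add_cancel (hlle x hx j)).trans x.2
    have h2 := single_le_sum (f := fun j => (x.1 j : ℕ) - l j) (fun _ _ => Nat.zero_le _)
      (mem_univ i)
    lia
  have ht : ∀ i, ∃ x ∈ T, c x = i ∨ (x.1 i : ℤ) ≤ Fintype.card J := fun i => by
    by_cases hi : i ∈ C
    · obtain ⟨x, hx, hxi⟩ := hcol i hi
      exact ⟨x, hTmem.2 hx, Or.inl hxi⟩
    · refine ⟨k₀, hk₀, Or.inr ?_⟩
      have := hub k₀ hk₀ i
      simp only [hl, if_neg hi] at this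
      lia
  choose t htT ht using ht
  refine ⟨k₀, t, fun i j => ?_, ht⟩
  have h1 := hlle _ (htT i) j
  have h2 := hub _ (htT i) j
  have h3 := hlle _ hk₀ j
  have h4 := hub _ hk₀ j
  rw [abs_le]
  constructor <;> lia

/-- The grid point `k` as a point of the standard simplex. -/
noncomputable def Grid.toReal {N : ℕ} (k : Grid J N) (i : J) : ℝ := (k.1 i : ℕ) / N

theorem Grid.toReal_mem {N : ℕ} (hN : 0 < N) (k : Grid J N) : k.toReal ∈ stdSimplex ℝ J := by
  refine ⟨fun i => by unfold Grid.toReal; positivity, ?_⟩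
  have : (N : ℝ) ≠ 0 := by positivity
  simp only [Grid.toReal]
  rw [← sum_div, ← Nat.cast_sum, k.2, div_self this]

omit [DecidableEq J] in
theorem exists_le_of_mem_stdSimplex [Nonempty J] {x y : J → ℝ} (hx : x ∈ stdSimplex ℝ J)
    (hy : y ∈ stdSimplex ℝ J) : ∃ i, x i ≤ y i := by
  obtain ⟨i, -, hi⟩ := exists_le_of_sum_le univ_nonempty (hx.2.trans hy.2.symm).le
  exact ⟨i, hi⟩

/-- Approximate form of Brouwer's theorem on the standard simplex. Grid points are coloured by an
index in which the map does not decrease the coordinate. -/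
theorem exists_approx_le [Nonempty J] {f : (J → ℝ) → J → ℝ}
    (hmaps : Set.MapsTo f (stdSimplex ℝ J) (stdSimplex ℝ J)) {N : ℕ} (hN : 0 < N) :
    ∃ x ∈ stdSimplex ℝ J, ∃ t : J → J → ℝ, (∀ i, t i ∈ stdSimplex ℝ J) ∧
      (∀ i j, |t i j - x j| ≤ Fintype.card J / N) ∧
      ∀ i, t i i ≤ f (t i) i + Fintype.card J / N := by
  choose c hc using fun k : Grid J N =>
    exists_le_of_mem_stdSimplex (k.toReal_mem hN) (hmaps (k.toReal_mem hN))
  obtain ⟨k₀, t, hclose, ht⟩ := Grid.exists_close_rainbow c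
  have hN' : (0 : ℝ) < N := by exact_mod_cast hN
  refine ⟨k₀.toReal, k₀.toReal_mem hN, fun i => (t i).toReal, fun i => (t i).toReal_mem hN,
    fun i j => ?_, fun i => ?_⟩
  · have := hclose i j
    unfold Grid.toReal
    rw [← sub_div, abs_div, abs_of_pos hN']
    gcongr
    exact_mod_cast this
  · rcases ht i with h | h
    · have := hc (t i)
      rw [h] at this
      exact this.trans (le_add_of_nonneg_right (by positivity))
    · have h1 : (t i).toReal i ≤ Fintype.card J / N := by
        unfold Grid.toReal
        gcongr
        exact_mod_cast h
      exact h1.trans (le_add_of_nonneg_left ((hmaps ((t i).toReal_mem hN)).1 i))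

/-- **Brouwer's fixed point theorem** for the standard simplex. -/
theorem exists_fixedPoint_stdSimplex [Nonempty J] {f : (J → ℝ) → J → ℝ}
    (hf : ContinuousOn f (stdSimplex ℝ J))
    (hmaps : Set.MapsTo f (stdSimplex ℝ J) (stdSimplex ℝ J)) :
    ∃ x ∈ stdSimplex ℝ J, f x = x := by
  choose x hx t ht hclose hle using fun n : ℕ => exists_approx_le hmaps n.succ_pos
  obtain ⟨z, hz, φ, hφ, hlim⟩ := (isCompact_stdSimplex ℝ J).tendsto_subseq hx
  have hδ : Tendsto (fun n => (Fintype.card J : ℝ) / ((φ n).succ : ℕ)) atTop (𝓝 0) :=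
    (tendsto_const_nhds.div_atTop (tendsto_natCast_atTop_atTop.comp
      (tendsto_add_atTop_nat 1))).comp hφ.tendsto_atTop
  have htlim : ∀ i, Tendsto (fun n => t (φ n) i) atTop (𝓝 z) := fun i => by
    rw [tendsto_pi_nhds] at hlim ⊢
    intro j
    have h0 : Tendsto (fun n => t (φ n) i j - x (φ n) j) atTop (𝓝 0) :=
      squeeze_zero_norm (fun n => hclose (φ n) i j) hδ
    simpa using h0.add (hlim j)
  have hfz := hmaps hz
  have key : ∀ i, z i ≤ f z i := fun i => by
    have h1 : Tendsto (fun n => f (t (φ n) i)) atTop (𝓝 (f z)) :=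
      (hf z hz).tendsto.comp (tendsto_nhdsWithin_iff.2
        ⟨htlim i, Eventually.of_forall fun n => ht (φ n) i⟩)
    have h2 := (tendsto_pi_nhds.1 h1 i).add hδ
    rw [add_zero] at h2
    exact le_of_tendsto_of_tendsto' (tendsto_pi_nhds.1 (htlim i) i) h2 fun n => hle (φ n) i
  -- Both points have coordinate sum `1`, so coordinatewise `≤` is equality.
  refine ⟨z, hz, funext fun i => ?_⟩
  exact (((sum_eq_sum_iff_of_le fun i _ => key i).1 (hz.2.trans hfz.2.symm)) i (mem_univ i)).symm

end FixedPoint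

/-! ### Logit equilibria -/

namespace NormalFormGame

open Finset

variable {ι : Type*} [Fintype ι] [DecidableEq ι] {A : ι → Type*} [∀ p, Fintype (A p)]
  [∀ p, DecidableEq (A p)]

/-- Conditioning a product distribution on the strategy of player `p`. -/
theorem sum_filter_prod_mul {τ : ∀ p, A p → ℝ} (hτ : ∀ p, ∑ s, τ p s = 1)
    (h : (∀ p, A p) → ℝ) (p : ι) (s : A p) :
    ∑ a : (∀ p, A p) with a p = s, (∏ q, τ q (a q)) * h a =
      τ p s * ∑ a : (∀ p, A p), (∏ q, τ q (a q)) * h (Function.update a p s) := by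
  set g : (∀ p, A p) → ℝ := fun a =>
    (∏ q ∈ univ.erase p, τ q (a q)) * h (Function.update a p s) with hg
  have hsplit : ∀ a : (∀ p, A p), (∏ q, τ q (a q)) * h (Function.update a p s) =
      τ p (a p) * g a := fun a => by
    rw [hg, ← mul_prod_erase univ (fun q => τ q (a q)) (mem_univ p), mul_assoc]
  have hgup : ∀ (a : ∀ p, A p) (r : A p), g (Function.update a p r) = g a := fun a r => by
    simp only [hg, Function.update_idem]
    congr 1
    exact prod_congr rfl fun q hq => by rw [Function.update_of_ne (mem_erase.1 hq).1]
  have hfib : ∀ r : A p, ∑ a : (∀ p, A p) with a p = r, g a =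
      ∑ a : (∀ p, A p) with a p = s, g a := fun r =>
    sum_nbij' (fun a => Function.update a p s) (fun a => Function.update a p r)
      (fun a _ => by simp) (fun a _ => by simp)
      (fun a ha => by
        rw [Function.update_idem, ← (mem_filter.1 ha).2, Function.update_eq_self])
      (fun a ha => by
        rw [Function.update_idem, ← (mem_filter.1 ha).2, Function.update_eq_self])
      (fun a _ => (hgup a s).symm)
  have hfibτ : ∀ r : A p, ∑ a : (∀ p, A p) with a p = r, τ p (a p) * g a =
      τ p r * ∑ a : (∀ p, A p) with a p = s, g a := fun r => by
    rw [← hfib r, mul_sum]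
    exact sum_congr rfl fun a ha => by rw [(mem_filter.1 ha).2]
  have hleft : ∑ a : (∀ p, A p) with a p = s, (∏ q, τ q (a q)) * h a =
      ∑ a : (∀ p, A p) with a p = s, τ p (a p) * g a :=
    sum_congr rfl fun a ha => by
      rw [← hsplit, ← (mem_filter.1 ha).2, Function.update_eq_self]
  rw [hleft, hfibτ, sum_congr rfl fun a _ => hsplit a, ← sum_fiberwise univ (fun a => a p),
    sum_congr rfl fun r _ => hfibτ r, ← sum_mul, hτ, one_mul]

omit [∀ p, DecidableEq (A p)] in
theorem sum_prod_eq_one {τ : ∀ p, A p → ℝ} (hτ : ∀ p, ∑ s, τ p s = 1) :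
    ∑ a : (∀ p, A p), ∏ p, τ p (a p) = 1 := by
  rw [← Fintype.piFinset_univ, ← prod_univ_sum]
  exact prod_eq_one fun p _ => hτ p

theorem marginal_prod {τ : ∀ p, A p → ℝ} (hτ : ∀ p, ∑ s, τ p s = 1) (p : ι) (s : A p) :
    marginal (fun a => ∏ q, τ q (a q)) p s = τ p s := by
  have := sum_filter_prod_mul hτ (fun _ => 1) p s
  simpa only [marginal, mul_one, sum_prod_eq_one hτ] using this

/-- The expected payoff of player `p` for always playing `s` while the others follow `σ`. -/
def deviationPayoff (G : ι → (∀ p, A p) → ℝ) (σ : (∀ p, A p) → ℝ) (p : ι) (s : A p) : ℝ :=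
  ∑ a, σ a * G p (Function.update a p s)

/-- The logit response of player `p` to `σ` at temperature `δ p`: the strategy `s` has weight
proportional to the exponential of its expected payoff divided by `δ p`. -/
noncomputable def logit (G : ι → (∀ p, A p) → ℝ) (δ : ι → ℝ) (σ : (∀ p, A p) → ℝ) (p : ι)
    (s : A p) : ℝ :=
  Real.exp (deviationPayoff G σ p s / δ p) / ∑ r, Real.exp (deviationPayoff G σ p r / δ p)

variable [∀ p, Nonempty (A p)] (G : ι → (∀ p, A p) → ℝ) (δ : ι → ℝ)

omit [∀ p, DecidableEq (A p)] in
theorem sum_exp_pos (σ : (∀ p, A p) → ℝ) (p : ι) :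
    0 < ∑ r, Real.exp (deviationPayoff G σ p r / δ p) :=
  sum_pos (fun _ _ => Real.exp_pos _) univ_nonempty

omit [∀ p, DecidableEq (A p)] in
theorem logit_pos (σ : (∀ p, A p) → ℝ) (p : ι) (s : A p) : 0 < logit G δ σ p s :=
  div_pos (Real.exp_pos _) (sum_exp_pos G δ σ p)

omit [∀ p, DecidableEq (A p)] in
theorem sum_logit (σ : (∀ p, A p) → ℝ) (p : ι) : ∑ s, logit G δ σ p s = 1 := by
  simp only [logit]
  rw [← sum_div, div_self (sum_exp_pos G δ σ p).ne']

omit [∀ p, DecidableEq (A p)] in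
theorem continuous_logit (p : ι) (s : A p) : Continuous fun σ => logit G δ σ p s := by
  unfold logit deviationPayoff
  refine Continuous.div (by fun_prop) (by fun_prop) fun σ => (sum_exp_pos G δ σ p).ne'

omit [∀ p, DecidableEq (A p)] in
/-- A strategy that loses `d` against another one has logit weight at most `exp (-d / δ p)`, and
`d * exp (-d / δ p) ≤ δ p`. -/
theorem logit_mul_sub_le {p : ι} (hδ : 0 < δ p) (σ : (∀ p, A p) → ℝ) (s s' : A p) :
    logit G δ σ p s * (deviationPayoff G σ p s' - deviationPayoff G σ p s) ≤ δ p := by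
  set d := deviationPayoff G σ p s' - deviationPayoff G σ p s with hd
  have hle : logit G δ σ p s ≤ Real.exp (-(d / δ p)) := by
    rw [logit, div_le_iff₀ (sum_exp_pos G δ σ p)]
    have h1 : Real.exp (deviationPayoff G σ p s' / δ p) ≤
        ∑ r, Real.exp (deviationPayoff G σ p r / δ p) :=
      single_le_sum (f := fun r => Real.exp (deviationPayoff G σ p r / δ p))
        (fun _ _ => (Real.exp_pos _).le) (mem_univ s')
    refine le_trans (le_of_eq ?_) (mul_le_mul_of_nonneg_left h1 (Real.exp_pos _).le)
    rw [← Real.exp_add]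
    congr 1
    rw [hd]
    ring
  rcases le_total d 0 with h | h
  · exact (mul_nonpos_of_nonneg_of_nonpos (logit_pos G δ σ p s).le h).trans hδ.le
  · refine (mul_le_mul_of_nonneg_right hle h).trans ?_
    rw [Real.exp_neg, inv_mul_le_iff₀ (Real.exp_pos _), ← div_le_iff₀ hδ]
    linarith [Real.add_one_le_exp (d / δ p)]

/-- Existence of a logit equilibrium: a joint distribution that is the product of the logit
responses to itself. It is a fixed point of a continuous self-map of the simplex of joint
distributions. -/
theorem exists_logit_equilibrium :
    ∃ σ ∈ stdSimplex ℝ (∀ p, A p), ∀ a, σ a = ∏ p, logit G δ σ p (a p) := by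
  obtain ⟨σ, hσ, h⟩ := exists_fixedPoint_stdSimplex
    (f := fun σ (a : ∀ p, A p) => ∏ p, logit G δ σ p (a p))
    (continuous_pi fun a => continuous_finsetProd _ fun p _ =>
      continuous_logit G δ p (a p)).continuousOn
    (fun σ _ => ⟨fun a => prod_nonneg fun p _ => (logit_pos G δ σ p (a p)).le,
      sum_prod_eq_one (sum_logit G δ σ)⟩)
  exact ⟨σ, hσ, fun a => (congrFun h a).symm⟩

variable {G δ}

theorem sum_deviationGain_le {p : ι} (hδ : 0 < δ p) {σ : (∀ p, A p) → ℝ}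
    (hσ : ∀ a, σ a = ∏ p, logit G δ σ p (a p)) (s s' : A p) :
    ∑ a : (∀ p, A p) with a p = s, σ a * deviationGain G p s' a ≤ δ p := by
  have key : ∑ a : (∀ p, A p) with a p = s, σ a * deviationGain G p s' a =
      logit G δ σ p s * (deviationPayoff G σ p s' - deviationPayoff G σ p s) := by
    rw [sum_congr rfl fun a _ => by rw [hσ a], sum_filter_prod_mul (sum_logit G δ σ),
      deviationPayoff, deviationPayoff, ← sum_sub_distrib]
    congr 1
    refine sum_congr rfl fun a _ => ?_
    rw [← hσ a, deviationGain, Function.update_idem, mul_sub]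
  rw [key]
  exact logit_mul_sub_le G δ hδ σ s s'

end NormalFormGame

theorem mainTheorem1 {ι : Type*} [Fintype ι] [DecidableEq ι] {A : ι → Type*}
    [∀ p, Fintype (A p)] [∀ p, DecidableEq (A p)] [∀ p, Nonempty (A p)]
    (G : ι → (∀ p, A p) → ℝ) (ε : ι → ℝ) (hε : ∀ p, 0 < ε p) :
    (∃ σ ∈ NormalFormGame.approxNE G ε, NormalFormGame.FullSupport σ) ∧
    (∃ σ ∈ NormalFormGame.approxCE G ε, NormalFormGame.FullSupport σ) ∧
    (∃ σ ∈ NormalFormGame.approxCCE G ε, NormalFormGame.FullSupport σ) := by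
  -- A coarse deviation sums `card (A p)` conditional ones, so each is allotted an equal share.
  set δ : ι → ℝ := fun p => ε p / Fintype.card (A p) with hδdef
  have hcard : ∀ p, (1 : ℝ) ≤ Fintype.card (A p) := fun p => by
    exact_mod_cast Fintype.card_pos (α := A p)
  have hδ : ∀ p, 0 < δ p := fun p => div_pos (hε p) (zero_lt_one.trans_le (hcard p))
  have hδε : ∀ p, δ p ≤ ε p := fun p => div_le_self (hε p).le (hcard p)
  obtain ⟨σ, hσ, hlogit⟩ := NormalFormGame.exists_logit_equilibrium G δ
  have hfull : NormalFormGame.FullSupport σ := fun a => by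
    rw [hlogit a]
    exact Finset.prod_pos fun p _ => NormalFormGame.logit_pos G δ σ p (a p)
  have hfact : NormalFormGame.Factorizes σ := fun a => by
    have hmarg : ∀ p s, NormalFormGame.marginal σ p s = NormalFormGame.logit G δ σ p s :=
      fun p s => by
        rw [← NormalFormGame.marginal_prod (NormalFormGame.sum_logit G δ σ) p s]
        exact congrArg (fun ρ => NormalFormGame.marginal ρ p s) (funext hlogit)
    simp only [hmarg]
    exact hlogit a
  have hCE := fun p (s s' : A p) =>
    NormalFormGame.sum_deviationGain_le (hδ p) hlogit s s'
  refine ⟨⟨σ, ⟨hσ, hfact, fun p s s' _ => ?_⟩, hfull⟩,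
    ⟨σ, ⟨hσ, fun p s s' _ => (hCE p s s').trans (hδε p)⟩, hfull⟩,
    ⟨σ, ⟨hσ, fun p s' => ?_⟩, hfull⟩⟩
  · simp only [← hfact _]
    exact (hCE p s s').trans (hδε p)
  · rw [← Finset.sum_fiberwise Finset.univ (fun a => a p)]
    refine (Finset.sum_le_sum fun s _ => hCE p s s').trans (le_of_eq ?_)
    rw [Finset.sum_const, Finset.card_univ, nsmul_eq_mul, hδdef,
      mul_div_cancel₀ _ (zero_lt_one.trans_le (hcard p)).ne']
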